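/- Let $X$ be a real Banach space (possibly nonseparable) with norm $\|\cdot\|$, let $\alpha\in(0,1]$, and suppose that $X$ admits a renorming with modulus of smoothness of power type $1+\alpha$, i.e. there are an equivalent norm $N$ on $X$ and a constant $C>0$ with $$N(x+h)^{1+\alpha}+N(x-h)^{1+\alpha}-2N(x)^{1+\alpha}\le C\,N(h)^{1+\alpha}\qquad\text{for all }x,h\in X$$ (such a space is super-reflexive). Let $\omega:(0,\infty)\to(0,\infty)$ be a non-decreasing function such that $\lim_{t\to0}\omega(t)=0$, $\lim_{t\to\infty}\omega(t)=\infty$, $\lim_{t\to0}t/\omega(t)=0$, and $\omega(2t)\le C_{\mathrm{db}}\,\omega(t)$ for all $t>0$, for some constant $C_{\mathrm{db}}>1$. For $f:X\to\mathbb R$ put $$\|f\|_{\dot C^{0,\omega}(X)}=\sup_{x\ne y}\frac{|f(x)-f(y)|}{\omega(\|x-y\|)},\qquad \operatorname{osc}^\omega_\delta(f)=\sup_{x\neq y,\ \|x-y\|=\delta}\frac{|f(x)-f(y)|}{\omega(\|x-y\|)}$$ (suprema in $[0,\infty]$, the supremum of the empty set being $0$), and let $\dot C^{0,\omega}(X)$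 be the set of all $f:X\to\mathbb R$ with $\|f\|_{\dot C^{0,\omega}(X)}<\infty$. Let $\dot{\mathrm{VC}}^{0,\omega}_{\mathrm{small}}(X)$ be the set of $f\in\dot C^{0,\omega}(X)$ with $\lim_{\delta\to0}\operatorname{osc}^\omega_\delta(f)=0$, and let $\dot{\mathrm{VC}}^{0,\omega}(X)$ be the set of those $f\in\dot{\mathrm{VC}}^{0,\omega}_{\mathrm{small}}(X)$ that satisfy in addition $$\lim_{\delta\to\infty}\operatorname{osc}^\omega_\delta(f)=0\qquad\text{and}\qquad \lim_{\delta\to\infty}\ \sup_{x\ne y,\ \min(\|x\|,\|y\|)>\delta}\frac{|f(x)-f(y)|}{\omega(\|x-y\|)}=0 .$$ Let $C^{1,\alpha}(X)$ be the set of everywhere Fréchet differentiable $f:X\to\mathbb R$ whose derivative $Df:X\to X^*$ is globally $\alpha$-Hölder continuous, $C^{1,\alpha}_{\mathrm{bs}}(X)$ the set of those $f\in C^{1,\alpha}(X)$ that vanish outside some ball, and $\mathrm{Lip}(X)$ the set of all globally Lipschitz $f:X\to\mathbb R$. For a class $\mathcal C$ of functions $X\to\mathbb R$, let $\overline{\mathcal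 C}^{\dot C^{0,\omega}(X)}$ be the set of those $f\in\dot C^{0,\omega}(X)$ for which there is a sequence $(f_n)_n\subset\mathcal C$ with $\lim_n\|f_n-f\|_{\dot C^{0,\omega}(X)}=0$. Then 1. $\overline{C^{1,\alpha}(X)\cap\mathrm{Lip}(X)\cap\dot C^{0,\omega}(X)}^{\dot C^{0,\omega}(X)}=\dot{\mathrm{VC}}^{0,\omega}_{\mathrm{small}}(X)$, and 2. $\overline{C^{1,\alpha}_{\mathrm{bs}}(X)}^{\dot C^{0,\omega}(X)}=\dot{\mathrm{VC}}^{0,\omega}(X)$. -/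

import Mathlib

open Filter Topology
open scoped ENNReal

namespace VanishingHolder

/-- The standing assumptions on a modulus `ω : (0, ∞) → (0, ∞)`. It is represented by a function
on `ℝ` whose values outside `(0, ∞)` are irrelevant. -/
structure IsModulus (ω : ℝ → ℝ) : Prop where
  pos : ∀ t, 0 < t → 0 < ω t
  mono : MonotoneOn ω (Set.Ioi 0)
  tendsto_zero : Tendsto ω (𝓝[>] 0) (𝓝 0)
  tendsto_atTop : Tendsto ω atTop atTop
  tendsto_div : Tendsto (fun t => t / ω t) (𝓝[>] 0) (𝓝 0)
  doubling : ∃ C : ℝ, 1 < C ∧ ∀ t, 0 < t → ω (2 * t) ≤ C * ω t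

section Spaces

variable {X Y : Type*} [NormedAddCommGroup X] [NormedAddCommGroup Y]

/-- The quotient `‖f x - f y‖ / ω ‖x - y‖`, used for `x ≠ y` only. -/
noncomputable def oscPair (ω : ℝ → ℝ) (f : X → Y) (x y : X) : ℝ≥0∞ :=
  ENNReal.ofReal (‖f x - f y‖ / ω ‖x - y‖)

/-- The oscillation of `f` at the scale `δ`: the supremum of the quotients over all pairs of
distinct points at distance exactly `δ`. -/
noncomputable def osc (ω : ℝ → ℝ) (f : X → Y) (δ : ℝ) : ℝ≥0∞ :=
  ⨆ (x : X) (y : X) (_ : x ≠ y ∧ ‖x - y‖ = δ), oscPair ω f x y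

/-- The supremum of the quotients over all pairs of distinct points of norm larger than `δ`. -/
noncomputable def oscFar (ω : ℝ → ℝ) (f : X → Y) (δ : ℝ) : ℝ≥0∞ :=
  ⨆ (x : X) (y : X) (_ : x ≠ y ∧ δ < min ‖x‖ ‖y‖), oscPair ω f x y

/-- The homogeneous Hölder seminorm with modulus `ω`, with values in `[0, ∞]`. -/
noncomputable def holderSeminorm (ω : ℝ → ℝ) (f : X → Y) : ℝ≥0∞ :=
  ⨆ (x : X) (y : X) (_ : x ≠ y), oscPair ω f x y

variable (X Y)

/-- The homogeneous Hölder space with modulus `ω`. -/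
def HolderSpace (ω : ℝ → ℝ) : Set (X → Y) :=
  {f | holderSeminorm ω f < ∞}

/-- Hölder functions with vanishing oscillation at small scales. -/
def VCsmall (ω : ℝ → ℝ) : Set (X → Y) :=
  {f | Tendsto (osc ω f) (𝓝[>] 0) (𝓝 0)} ∩ HolderSpace X Y ω

/-- Hölder functions with vanishing oscillation at large scales. -/
def VClarge (ω : ℝ → ℝ) : Set (X → Y) :=
  {f | Tendsto (osc ω f) atTop (𝓝 0)} ∩ HolderSpace X Y ω

/-- Hölder functions with vanishing oscillation far away from the origin. -/
def VCfar (ω : ℝ → ℝ) : Set (X → Y) :=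
  {f | Tendsto (oscFar ω f) atTop (𝓝 0)} ∩ HolderSpace X Y ω

/-- Hölder functions with vanishing oscillation at small, far and large scales. -/
def VC (ω : ℝ → ℝ) : Set (X → Y) :=
  VCsmall X Y ω ∩ VCfar X Y ω ∩ VClarge X Y ω

variable {X Y}

/-- The closure of a class `A` in the Hölder seminorm: those functions of the Hölder space that
are limits, in the seminorm, of sequences from `A`. -/
def holderClosure (ω : ℝ → ℝ) (A : Set (X → Y)) : Set (X → Y) :=
  {f | f ∈ HolderSpace X Y ω ∧
    ∃ u : ℕ → X → Y, (∀ n, u n ∈ A) ∧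
      Tendsto (fun n => holderSeminorm ω (u n - f)) atTop (𝓝 0)}

variable (X)

/-- Globally Lipschitz real-valued functions. -/
def LipFun : Set (X → ℝ) :=
  {f | ∃ K, LipschitzWith K f}

/-- Real-valued functions vanishing outside some closed ball around the origin. -/
def BoundedSupport : Set (X → ℝ) :=
  {f | ∃ R : ℝ, 0 < R ∧ ∀ x : X, R < ‖x‖ → f x = 0}

/-- Real-valued functions that are Fréchet differentiable everywhere, with a globally `α`-Hölder
derivative `X → X*`. -/
def C1Holder [NormedSpace ℝ X] (α : ℝ) : Set (X → ℝ) :=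
  {f | Differentiable ℝ f ∧ holderSeminorm (fun t => t ^ α) (fderiv ℝ f) < ∞}

/-- `X` has an equivalent norm with modulus of smoothness of power type `1 + α`. -/
def HasPowerTypeRenorming [NormedSpace ℝ X] (α : ℝ) : Prop :=
  ∃ N : Seminorm ℝ X,
    (∃ a b : ℝ, 0 < a ∧ 0 < b ∧ ∀ x, a * ‖x‖ ≤ N x ∧ N x ≤ b * ‖x‖) ∧
    ∃ C : ℝ, 0 < C ∧ ∀ x h : X,
      N (x + h) ^ (1 + α) + N (x - h) ^ (1 + α) - 2 * N x ^ (1 + α) ≤ C * N h ^ (1 + α)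

end Spaces

end VanishingHolder

namespace VanishingHolder

/-! ### Epsilon forms of the seminorm and oscillation conditions. -/

section Characterizations

variable {X Y : Type*} [NormedAddCommGroup X] [NormedAddCommGroup Y] {ω : ℝ → ℝ}

/-! The vanishing conditions survive limits in the seminorm, and they hold on the generating
classes: Lipschitz functions oscillate little at small scales because `t / ω t → 0`, and bounded
functions do so at large scales because `ω → ∞`. This gives the inclusions of the closures.

The converse rests on a smoothing that preserves every bound `|f (x + h) - f x| ≤ c` valid for all
`x` (`exists_mem_C1Holder_approx`). Inf- and sup-convolution of `f` with a multiple of `N ^ (1 + α)`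
give, after shifts by `ε`, a semiconcave `g` and a semiconvex `w` with `f - ε ≤ w ≤ f ≤ g ≤ f + ε`.
The largest semiconvex minorant of `g` lies between them and inherits semiconcavity from `g`. Its
second differences are therefore of order `‖h‖ ^ (1 + α)` from both sides, which forces a Hölder
derivative. Both constructions are monotone and commute with translations and added constants, so
moduli pass from `f` to the result.

Hence the small oscillation of `f` below a scale `δ` is inherited, and above `δ` uniform closeness
of order `ε * ω δ` suffices since `ω` is monotone. For bounded support, `f` is first clamped between
`-m` and `m`, where `m` is a wide cut-off of small seminorm. After smoothing, a soft threshold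
restores the support. -/

theorem oscPair_le_ofReal_iff (hω : ∀ t, 0 < t → 0 < ω t) {f : X → Y} {x y : X} (hxy : x ≠ y)
    {c : ℝ} (hc : 0 ≤ c) :
    oscPair ω f x y ≤ ENNReal.ofReal c ↔ ‖f x - f y‖ ≤ c * ω ‖x - y‖ := by
  rw [oscPair, ENNReal.ofReal_le_ofReal_iff hc, div_le_iff₀ (hω _ (norm_sub_pos_iff.2 hxy))]

theorem holderSeminorm_le_ofReal_iff (hω : ∀ t, 0 < t → 0 < ω t) {f : X → Y} {c : ℝ}
    (hc : 0 ≤ c) :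
    holderSeminorm ω f ≤ ENNReal.ofReal c ↔ ∀ x y, x ≠ y → ‖f x - f y‖ ≤ c * ω ‖x - y‖ := by
  simp only [holderSeminorm, iSup_le_iff]
  exact forall₃_congr fun x y h => oscPair_le_ofReal_iff hω h hc

theorem osc_le_ofReal_iff (hω : ∀ t, 0 < t → 0 < ω t) {f : X → Y} {c δ : ℝ} (hc : 0 ≤ c) :
    osc ω f δ ≤ ENNReal.ofReal c ↔
      ∀ x y, x ≠ y ∧ ‖x - y‖ = δ → ‖f x - f y‖ ≤ c * ω ‖x - y‖ := by
  simp only [osc, iSup_le_iff]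
  exact forall₃_congr fun x y h => oscPair_le_ofReal_iff hω h.1 hc

theorem oscFar_le_ofReal_iff (hω : ∀ t, 0 < t → 0 < ω t) {f : X → Y} {c δ : ℝ} (hc : 0 ≤ c) :
    oscFar ω f δ ≤ ENNReal.ofReal c ↔
      ∀ x y, x ≠ y ∧ δ < min ‖x‖ ‖y‖ → ‖f x - f y‖ ≤ c * ω ‖x - y‖ := by
  simp only [oscFar, iSup_le_iff]
  exact forall₃_congr fun x y h => oscPair_le_ofReal_iff hω h.1 hc

theorem tendsto_zero_iff_forall_le_ofReal {ι : Type*} {l : Filter ι} {F : ι → ℝ≥0∞} :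
    Tendsto F l (𝓝 0) ↔ ∀ ε : ℝ, 0 < ε → ∀ᶠ i in l, F i ≤ ENNReal.ofReal ε := by
  rw [ENNReal.tendsto_nhds_zero]
  refine ⟨fun h ε hε => h _ (ENNReal.ofReal_pos.2 hε), fun h ε hε => ?_⟩
  obtain ⟨r, hr0, hr⟩ := ENNReal.lt_iff_exists_nnreal_btwn.1 hε
  filter_upwards [h r (by exact_mod_cast hr0)] with i hi
  exact hi.trans (by simpa using hr.le)

theorem mem_holderSpace_iff (hω : ∀ t, 0 < t → 0 < ω t) {f : X → Y} :
    f ∈ HolderSpace X Y ω ↔ ∃ c, 0 ≤ c ∧ ∀ x y, x ≠ y → ‖f x - f y‖ ≤ c * ω ‖x - y‖ := by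
  constructor
  · intro h
    refine ⟨(holderSeminorm ω f).toReal, ENNReal.toReal_nonneg, ?_⟩
    rw [← holderSeminorm_le_ofReal_iff hω ENNReal.toReal_nonneg]
    exact ENNReal.ofReal_toReal (ne_of_lt h) |>.ge
  · rintro ⟨c, hc, h⟩
    exact ((holderSeminorm_le_ofReal_iff hω hc).2 h).trans_lt ENNReal.ofReal_lt_top

theorem tendsto_osc_zero_iff (hω : ∀ t, 0 < t → 0 < ω t) {f : X → Y} :
    Tendsto (osc ω f) (𝓝[>] 0) (𝓝 0) ↔ ∀ ε : ℝ, 0 < ε → ∃ δ, 0 < δ ∧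
      ∀ x y, x ≠ y → ‖x - y‖ < δ → ‖f x - f y‖ ≤ ε * ω ‖x - y‖ := by
  rw [tendsto_zero_iff_forall_le_ofReal]
  refine forall₂_congr fun ε hε => ?_
  rw [(nhdsGT_basis (0 : ℝ)).eventually_iff]
  refine exists_congr fun δ => and_congr_right fun _ => ?_
  simp only [osc_le_ofReal_iff hω hε.le]
  refine ⟨fun h x y hxy hlt => h ⟨norm_sub_pos_iff.2 hxy, hlt⟩ x y ⟨hxy, rfl⟩, ?_⟩
  rintro h t ⟨_, ht⟩ x y ⟨hxy, rfl⟩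
  exact h x y hxy ht

theorem tendsto_osc_atTop_iff (hω : ∀ t, 0 < t → 0 < ω t) {f : X → Y} :
    Tendsto (osc ω f) atTop (𝓝 0) ↔ ∀ ε : ℝ, 0 < ε → ∃ T,
      ∀ x y, x ≠ y → T ≤ ‖x - y‖ → ‖f x - f y‖ ≤ ε * ω ‖x - y‖ := by
  rw [tendsto_zero_iff_forall_le_ofReal]
  refine forall₂_congr fun ε hε => ?_
  rw [eventually_atTop]
  refine exists_congr fun T => ?_
  simp only [osc_le_ofReal_iff hω hε.le]
  refine ⟨fun h x y hxy hle => h _ hle x y ⟨hxy, rfl⟩, ?_⟩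
  rintro h t ht x y ⟨hxy, rfl⟩
  exact h x y hxy ht

theorem tendsto_oscFar_atTop_iff (hω : ∀ t, 0 < t → 0 < ω t) {f : X → Y} :
    Tendsto (oscFar ω f) atTop (𝓝 0) ↔ ∀ ε : ℝ, 0 < ε → ∃ T,
      ∀ x y, x ≠ y → T < ‖x‖ → T < ‖y‖ → ‖f x - f y‖ ≤ ε * ω ‖x - y‖ := by
  rw [tendsto_zero_iff_forall_le_ofReal]
  refine forall₂_congr fun ε hε => ?_
  rw [eventually_atTop]
  refine exists_congr fun T => ?_
  simp only [oscFar_le_ofReal_iff hω hε.le]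
  refine ⟨fun h x y hxy hx hy => h T le_rfl x y ⟨hxy, lt_min hx hy⟩, ?_⟩
  rintro h t ht x y ⟨hxy, hlt⟩
  exact h x y hxy (ht.trans_lt (hlt.trans_le (min_le_left _ _)))
    (ht.trans_lt (hlt.trans_le (min_le_right _ _)))

theorem mem_holderClosure_iff (hω : ∀ t, 0 < t → 0 < ω t) {f : X → Y} {A : Set (X → Y)} :
    f ∈ holderClosure ω A ↔ f ∈ HolderSpace X Y ω ∧ ∀ ε : ℝ, 0 < ε → ∃ u ∈ A,
      ∀ x y, x ≠ y → ‖(u x - f x) - (u y - f y)‖ ≤ ε * ω ‖x - y‖ := by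
  refine and_congr_right fun _ => ⟨?_, fun h => ?_⟩
  · rintro ⟨u, huA, hu⟩ ε hε
    obtain ⟨n, hn⟩ := (tendsto_zero_iff_forall_le_ofReal.1 hu ε hε).exists
    exact ⟨u n, huA n, (holderSeminorm_le_ofReal_iff hω hε.le).1 hn⟩
  · choose u huA hu using fun n : ℕ => h (1 / (n + 1 : ℝ)) Nat.one_div_pos_of_nat
    refine ⟨u, huA, tendsto_of_tendsto_of_tendsto_of_le_of_le tendsto_const_nhds
      (g := fun _ => 0) (h := fun n : ℕ => ENNReal.ofReal (1 / (n + 1 : ℝ))) ?_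
      (fun _ => zero_le)
      fun n => (holderSeminorm_le_ofReal_iff hω Nat.one_div_pos_of_nat.le).2 (hu n)⟩
    simpa using ENNReal.tendsto_ofReal (tendsto_one_div_add_atTop_nhds_zero_nat (𝕜 := ℝ))

end Characterizations

/-! ### From second differences to Hölder derivatives. -/

section Smoothness

variable {X : Type*} [NormedAddCommGroup X] [NormedSpace ℝ X]

/-- A continuous function whose second differences are of order `‖h‖ ^ p` with `p > 1` has
first-order Taylor expansions with remainder of order `‖h‖ ^ p`. -/
theorem exists_clm_of_secondDiff {u : X → ℝ} {K p : ℝ} (hp : 1 < p) (hK : 0 ≤ K)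
    (hu : Continuous u) (h2 : ∀ x h, |u (x + h) + u (x - h) - 2 * u x| ≤ K * ‖h‖ ^ p) :
    ∃ K' : ℝ, 0 ≤ K' ∧ ∀ x, ∃ D : X →L[ℝ] ℝ, ∀ h, |u (x + h) - u x - D h| ≤ K' * ‖h‖ ^ p := by
  -- Each halving of the step multiplies the rescaled error `2 ^ n * K * ‖2⁻ⁿ v‖ ^ p` by this ratio,
  -- which is below 1 because `p > 1`.
  set r : ℝ := 2 * (2⁻¹ : ℝ) ^ p with hr
  have hr0 : 0 ≤ r := by positivity
  have hr1 : r < 1 := by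
    have : (2⁻¹ : ℝ) ^ p < (2⁻¹ : ℝ) ^ (1 : ℝ) :=
      Real.rpow_lt_rpow_of_exponent_gt (by norm_num) (by norm_num) hp
    rw [Real.rpow_one] at this
    linarith
  have hscale : ∀ (n : ℕ) (v : X),
      (2 : ℝ) ^ n * (K * ‖(2⁻¹ : ℝ) ^ n • v‖ ^ p) = K * ‖v‖ ^ p * r ^ n := by
    intro n v
    rw [norm_smul, Real.mul_rpow (norm_nonneg _) (norm_nonneg _), Real.norm_of_nonneg (by positivity),
      hr, mul_pow, ← Real.rpow_natCast ((2⁻¹ : ℝ) ^ p), ← Real.rpow_mul (by norm_num),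
      ← Real.rpow_natCast (2⁻¹ : ℝ), ← Real.rpow_mul (by norm_num), mul_comm p]
    ring
  refine ⟨K / 2 ^ p / (1 - r), div_nonneg (by positivity) (by linarith), fun x => ?_⟩
  -- Dyadic difference quotients. Consecutive ones differ by a rescaled second difference centred at
  -- the midpoint `x + 2⁻ⁿ⁻¹ h`, so they converge geometrically.
  let a : X → ℕ → ℝ := fun h n => 2 ^ n * (u (x + (2⁻¹ : ℝ) ^ n • h) - u x)
  have hstep : ∀ h n, dist (a h n) (a h (n + 1)) ≤ K / 2 ^ p * ‖h‖ ^ p * r ^ n := by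
    intro h n
    have e1 : a h n - a h (n + 1) = 2 ^ n * (u (x + (2⁻¹ : ℝ) ^ n • (2⁻¹ : ℝ) • h
        + (2⁻¹ : ℝ) ^ n • (2⁻¹ : ℝ) • h) + u (x + (2⁻¹ : ℝ) ^ n • (2⁻¹ : ℝ) • h
        - (2⁻¹ : ℝ) ^ n • (2⁻¹ : ℝ) • h) - 2 * u (x + (2⁻¹ : ℝ) ^ n • (2⁻¹ : ℝ) • h)) := by
      have e2 : x + (2⁻¹ : ℝ) ^ n • (2⁻¹ : ℝ) • h + (2⁻¹ : ℝ) ^ n • (2⁻¹ : ℝ) • h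
          = x + (2⁻¹ : ℝ) ^ n • h := by module
      have e3 : (2⁻¹ : ℝ) ^ (n + 1) • h = (2⁻¹ : ℝ) ^ n • (2⁻¹ : ℝ) • h := by
        rw [pow_succ, mul_smul]
      rw [e2, add_sub_cancel_right]
      simp only [a, e3]
      ring
    rw [Real.dist_eq, e1, abs_mul, abs_of_nonneg (by positivity : (0 : ℝ) ≤ 2 ^ n)]
    refine (mul_le_mul_of_nonneg_left (h2 _ _) (by positivity)).trans ?_
    rw [hscale, norm_smul, Real.mul_rpow (norm_nonneg _) (norm_nonneg _),
      Real.norm_of_nonneg (by positivity), Real.inv_rpow (by norm_num)]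
    exact le_of_eq (by ring)
  have hlim : ∀ h, ∃ d, Tendsto (a h) atTop (𝓝 d) := fun h =>
    cauchySeq_tendsto_of_complete (cauchySeq_of_le_geometric r _ hr1 (hstep h))
  choose d hd using hlim
  have happ : ∀ h, |u (x + h) - u x - d h| ≤ K / 2 ^ p / (1 - r) * ‖h‖ ^ p := by
    intro h
    have := dist_le_of_le_geometric_of_tendsto₀ r _ hr1 (hstep h) (hd h)
    rw [Real.dist_eq] at this
    simp only [a, pow_zero, one_smul, one_mul] at this
    refine this.trans (le_of_eq (by ring))
  have hdouble : ∀ h, d ((2⁻¹ : ℝ) • h) = 2⁻¹ * d h := by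
    intro h
    refine tendsto_nhds_unique (hd _) ?_
    refine (((tendsto_add_atTop_iff_nat 1).2 (hd h)).const_mul 2⁻¹).congr fun n => ?_
    simp only [a, pow_succ, mul_smul]
    ring
  -- The second difference with end points `x + 2⁻ⁿ h` and `x + 2⁻ⁿ k` yields Jensen's equation in
  -- the limit; `hdouble` turns it into additivity.
  have hadd : ∀ h k, d (h + k) = d h + d k := by
    intro h k
    have hz : Tendsto (fun n => K * ‖(2⁻¹ : ℝ) • (h - k)‖ ^ p * r ^ n) atTop (𝓝 0) := by
      simpa using (tendsto_pow_atTop_nhds_zero_of_lt_one hr0 hr1).const_mul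
        (K * ‖(2⁻¹ : ℝ) • (h - k)‖ ^ p)
    have ht : Tendsto (fun n => a h n + a k n - 2 * a ((2⁻¹ : ℝ) • (h + k)) n) atTop (𝓝 0) := by
      refine squeeze_zero_norm (fun n => ?_) hz
      have e1 : a h n + a k n - 2 * a ((2⁻¹ : ℝ) • (h + k)) n = 2 ^ n *
          (u (x + (2⁻¹ : ℝ) ^ n • (2⁻¹ : ℝ) • (h + k) + (2⁻¹ : ℝ) ^ n • (2⁻¹ : ℝ) • (h - k))
          + u (x + (2⁻¹ : ℝ) ^ n • (2⁻¹ : ℝ) • (h + k) - (2⁻¹ : ℝ) ^ n • (2⁻¹ : ℝ) • (h - k))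
          - 2 * u (x + (2⁻¹ : ℝ) ^ n • (2⁻¹ : ℝ) • (h + k))) := by
        have e2 : x + (2⁻¹ : ℝ) ^ n • (2⁻¹ : ℝ) • (h + k) + (2⁻¹ : ℝ) ^ n • (2⁻¹ : ℝ) • (h - k)
            = x + (2⁻¹ : ℝ) ^ n • h := by module
        have e3 : x + (2⁻¹ : ℝ) ^ n • (2⁻¹ : ℝ) • (h + k) - (2⁻¹ : ℝ) ^ n • (2⁻¹ : ℝ) • (h - k)
            = x + (2⁻¹ : ℝ) ^ n • k := by module
        rw [e2, e3]
        simp only [a]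
        ring
      rw [Real.norm_eq_abs, e1, abs_mul, abs_of_nonneg (by positivity : (0 : ℝ) ≤ 2 ^ n), ← hscale]
      exact mul_le_mul_of_nonneg_left (h2 _ _) (by positivity)
    have := tendsto_nhds_unique ht (((hd h).add (hd k)).sub ((hd _).const_mul 2))
    rw [hdouble] at this
    linarith
  let A : X →+ ℝ := AddMonoidHom.mk' d hadd
  have hA : Continuous A := by
    refine continuous_of_continuousAt_zero A ?_
    have h0 : Tendsto (fun h : X => |u (x + h) - u x| + K / 2 ^ p / (1 - r) * ‖h‖ ^ p) (𝓝 0)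
        (𝓝 0) := by
      have : Continuous (fun h : X => |u (x + h) - u x| + K / 2 ^ p / (1 - r) * ‖h‖ ^ p) := by
        have : Continuous (fun h : X => ‖h‖ ^ p) :=
          continuous_norm.rpow_const fun _ => Or.inr (by linarith)
        fun_prop
      simpa [Real.zero_rpow (by linarith : p ≠ 0)] using this.tendsto 0
    rw [ContinuousAt, map_zero]
    refine squeeze_zero_norm (fun h => ?_) h0
    have := happ h
    have h3 := abs_sub_abs_le_abs_sub (d h) (u (x + h) - u x)
    rw [abs_sub_comm (d h)] at h3
    change |d h| ≤ _
    linarith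
  exact ⟨A.toRealLinearMap hA, happ⟩

theorem mem_C1Holder_iff {α : ℝ} {f : X → ℝ} :
    f ∈ C1Holder X α ↔ Differentiable ℝ f ∧ ∃ c, 0 ≤ c ∧
      ∀ x y, x ≠ y → ‖fderiv ℝ f x - fderiv ℝ f y‖ ≤ c * ‖x - y‖ ^ α :=
  and_congr_right fun _ => mem_holderSpace_iff (ω := fun t => t ^ α) fun _ ht => by positivity

/-- A uniformly locally bounded continuous function whose second differences are of order
`‖h‖ ^ (1 + α)` is Lipschitz and has an `α`-Hölder derivative. -/
theorem mem_C1Holder_inter_LipFun_of_secondDiff {u : X → ℝ} {α K B : ℝ} (hα : 0 < α)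
    (hK : 0 ≤ K) (hu : Continuous u)
    (h2 : ∀ x h, |u (x + h) + u (x - h) - 2 * u x| ≤ K * ‖h‖ ^ (1 + α))
    (hB : ∀ x h, ‖h‖ ≤ 1 → |u (x + h) - u x| ≤ B) : u ∈ C1Holder X α ∩ LipFun X := by
  obtain ⟨C, hC, hT⟩ := exists_clm_of_secondDiff (by linarith) hK hu h2
  choose D hD using hT
  have hB0 : 0 ≤ B := (abs_nonneg _).trans (hB 0 0 (by simp))
  have hderiv : ∀ x, HasFDerivAt u (D x) x := by
    intro x
    rw [hasFDerivAt_iff_isLittleO_nhds_zero, Asymptotics.isLittleO_iff]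
    intro c hc
    have hlim : Tendsto (fun h : X => C * ‖h‖ ^ α) (𝓝 0) (𝓝 0) := by
      have : Continuous (fun h : X => C * ‖h‖ ^ α) :=
        continuous_const.mul (continuous_norm.rpow_const fun _ => Or.inr hα.le)
      simpa [Real.zero_rpow hα.ne'] using this.tendsto 0
    filter_upwards [hlim.eventually (gt_mem_nhds hc)] with h hh
    refine (hD x h).trans ?_
    rw [Real.rpow_one_add' (norm_nonneg _) (by linarith)]
    nlinarith [norm_nonneg h]
  have hfd : fderiv ℝ u = D := funext fun x => (hderiv x).fderiv
  have hdiff : Differentiable ℝ u := fun x => (hderiv x).differentiableAt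
  refine ⟨mem_C1Holder_iff.2 ⟨hdiff, C * (2 + 2 ^ (1 + α)), by positivity, ?_⟩, ?_⟩
  · intro x y hxy
    rw [hfd]
    have hr : 0 < ‖x - y‖ := norm_sub_pos_iff.2 hxy
    refine ContinuousLinearMap.opNorm_le_of_unit_norm (by positivity) fun v hv => ?_
    set r := ‖x - y‖ with hrdef
    have hk : ‖y - x‖ = r := norm_sub_rev _ _
    have hh : ‖r • v‖ = r := by rw [norm_smul, hv, mul_one, Real.norm_of_nonneg hr.le]
    -- The value at `y + r • v` is expanded at `y` and at `x`, and the value at `y` is expanded at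
    -- `x`. The remainders have steps `r`, at most `2 * r`, and `r`, whence the constant.
    have t1 := hD y (r • v)
    have t2 := hD x ((y - x) + r • v)
    have t3 := hD x (y - x)
    have hkh : ‖(y - x) + r • v‖ ^ (1 + α) ≤ 2 ^ (1 + α) * r ^ (1 + α) := by
      rw [← Real.mul_rpow (by norm_num) hr.le]
      exact Real.rpow_le_rpow (norm_nonneg _) ((norm_add_le _ _).trans (by linarith))
        (by linarith)
    replace hkh := mul_le_mul_of_nonneg_left hkh hC
    rw [hh] at t1
    rw [hk] at t3
    rw [← add_assoc, add_sub_cancel, map_add] at t2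
    rw [add_sub_cancel] at t3
    have key : |r * ((D x - D y) v)| ≤ C * (2 + 2 ^ (1 + α)) * r ^ (1 + α) := by
      have e : r * ((D x - D y) v) = D x (r • v) - D y (r • v) := by
        simp [mul_sub]
      rw [e, abs_le]
      rw [abs_le] at t1 t2 t3
      constructor <;> linarith
    rw [Real.rpow_one_add' hr.le (by linarith), abs_mul, abs_of_pos hr] at key
    rw [Real.norm_eq_abs]
    exact le_of_mul_le_mul_left (key.trans_eq (by ring)) hr
  · refine ⟨Real.toNNReal (B + C), lipschitzWith_of_nnnorm_fderiv_le hdiff fun x => ?_⟩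
    rw [hfd, ← NNReal.coe_le_coe, coe_nnnorm, Real.coe_toNNReal _ (by positivity)]
    refine ContinuousLinearMap.opNorm_le_of_unit_norm (by positivity) fun v hv => ?_
    have t := hD x v
    have b := hB x v hv.le
    rw [hv, Real.one_rpow, mul_one] at t
    rw [Real.norm_eq_abs]
    rw [abs_le] at *
    constructor <;> linarith

end Smoothness

end VanishingHolder

namespace VanishingHolder

/-! ### Infimal convolution and semiconvex minorants. -/

section InfConvolution

variable {X : Type*} [AddCommGroup X]

/-- The infimal convolution of `f` with the kernel `k`. -/
noncomputable def infConv (k f : X → ℝ) (x : X) : ℝ := ⨅ y, (f y + k (x - y))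

variable {k f : X → ℝ} {ε : ℝ}

theorem infConv_bddBelow (hk : ∀ x y, f x - ε ≤ f y + k (x - y)) (x : X) :
    BddBelow (Set.range fun y => f y + k (x - y)) :=
  ⟨f x - ε, by rintro _ ⟨y, rfl⟩; exact hk x y⟩

theorem sub_le_infConv (hk : ∀ x y, f x - ε ≤ f y + k (x - y)) (x : X) :
    f x - ε ≤ infConv k f x :=
  le_ciInf (hk x)

theorem infConv_le (hk : ∀ x y, f x - ε ≤ f y + k (x - y)) (x y : X) :
    infConv k f x ≤ f y + k (x - y) :=
  ciInf_le (infConv_bddBelow hk x) y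

theorem infConv_le_self (hk : ∀ x y, f x - ε ≤ f y + k (x - y)) (h0 : k 0 = 0) (x : X) :
    infConv k f x ≤ f x := by
  simpa [h0] using infConv_le hk x x

/-- A competitor `y` for `x` gives the competitor `y + h` for `x + h` with the same kernel value. -/
theorem infConv_add_le (hk : ∀ x y, f x - ε ≤ f y + k (x - y)) {h : X} {c : ℝ}
    (hf : ∀ x, f (x + h) ≤ f x + c) (x : X) : infConv k f (x + h) ≤ infConv k f x + c := by
  rw [← sub_le_iff_le_add]
  refine le_ciInf fun y => ?_
  have h1 := infConv_le hk (x + h) (y + h)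
  rw [add_sub_add_right_eq_sub] at h1
  linarith [hf y]

/-- Using one competitor `y` at all three points cancels `f`, so only the kernel's second
differences enter. -/
theorem infConv_secondDiff_le (hk : ∀ x y, f x - ε ≤ f y + k (x - y)) {h : X} {c : ℝ}
    (hc : ∀ z, k (z + h) + k (z - h) - 2 * k z ≤ c) (x : X) :
    infConv k f (x + h) + infConv k f (x - h) - 2 * infConv k f x ≤ c := by
  suffices (infConv k f (x + h) + infConv k f (x - h) - c) / 2 ≤ infConv k f x by linarith
  refine le_ciInf fun y => ?_
  have h1 := infConv_le hk (x + h) y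
  have h2 := infConv_le hk (x - h) y
  rw [add_sub_right_comm] at h1
  rw [sub_right_comm] at h2
  linarith [hc (x - y)]

/-- The second differences of `u` are bounded below by `-φ`. -/
def IsSemiconvex (φ u : X → ℝ) : Prop :=
  ∀ x h, -φ h ≤ u (x + h) + u (x - h) - 2 * u x

/-- The largest semiconvex minorant of `g`. -/
noncomputable def semiconvexMinorant (φ g : X → ℝ) (x : X) : ℝ :=
  ⨆ v : {v : X → ℝ // IsSemiconvex φ v ∧ ∀ x, v x ≤ g x}, v.1 x

variable {φ g v : X → ℝ}

theorem le_semiconvexMinorant (hv : IsSemiconvex φ v) (hvg : ∀ x, v x ≤ g x) (x : X) :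
    v x ≤ semiconvexMinorant φ g x :=
  le_ciSup (f := fun v : {v : X → ℝ // IsSemiconvex φ v ∧ ∀ x, v x ≤ g x} => v.1 x)
    ⟨g x, by rintro _ ⟨w, rfl⟩; exact w.2.2 x⟩ ⟨v, hv, hvg⟩

theorem semiconvexMinorant_le (hv : IsSemiconvex φ v) (hvg : ∀ x, v x ≤ g x) (x : X) :
    semiconvexMinorant φ g x ≤ g x :=
  have : Nonempty {v : X → ℝ // IsSemiconvex φ v ∧ ∀ x, v x ≤ g x} := ⟨v, hv, hvg⟩
  ciSup_le fun w => w.2.2 x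

theorem isSemiconvex_semiconvexMinorant (hv : IsSemiconvex φ v) (hvg : ∀ x, v x ≤ g x) :
    IsSemiconvex φ (semiconvexMinorant φ g) := by
  intro x h
  have : Nonempty {v : X → ℝ // IsSemiconvex φ v ∧ ∀ x, v x ≤ g x} := ⟨v, hv, hvg⟩
  suffices semiconvexMinorant φ g x ≤
      (semiconvexMinorant φ g (x + h) + semiconvexMinorant φ g (x - h) + φ h) / 2 by linarith
  refine ciSup_le fun w => ?_
  linarith [w.2.1 x h, le_semiconvexMinorant w.2.1 w.2.2 (x + h),
    le_semiconvexMinorant w.2.1 w.2.2 (x - h)]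

/-- The translate lowered by `c` is again a semiconvex minorant of `g`, so maximality applies. -/
theorem semiconvexMinorant_add_le (hv : IsSemiconvex φ v) (hvg : ∀ x, v x ≤ g x) {h : X} {c : ℝ}
    (hg : ∀ x, g (x + h) ≤ g x + c) (x : X) :
    semiconvexMinorant φ g (x + h) ≤ semiconvexMinorant φ g x + c := by
  rw [← sub_le_iff_le_add]
  refine le_semiconvexMinorant (v := fun x => semiconvexMinorant φ g (x + h) - c)
    (fun y l => ?_) (fun y => ?_) x
  · have := isSemiconvex_semiconvexMinorant hv hvg (y + h) l
    rw [add_right_comm, ← sub_add_eq_add_sub y l h] at this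
    beta_reduce
    linarith
  · linarith [hg y, semiconvexMinorant_le hv hvg (y + h)]

/-- The largest semiconvex minorant of a semiconcave function is semiconcave: by translation
invariance its averages at `x + h` and `x - h`, lowered suitably, are semiconvex minorants. -/
theorem semiconvexMinorant_secondDiff_le (hv : IsSemiconvex φ v) (hvg : ∀ x, v x ≤ g x) {h : X}
    {c : ℝ} (hg : ∀ x, g (x + h) + g (x - h) - 2 * g x ≤ c) (x : X) :
    semiconvexMinorant φ g (x + h) + semiconvexMinorant φ g (x - h)
      - 2 * semiconvexMinorant φ g x ≤ c := by
  suffices (semiconvexMinorant φ g (x + h) + semiconvexMinorant φ g (x - h) - c) / 2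
      ≤ semiconvexMinorant φ g x by linarith
  refine le_semiconvexMinorant (v := fun x =>
    (semiconvexMinorant φ g (x + h) + semiconvexMinorant φ g (x - h) - c) / 2)
    (fun y l => ?_) (fun y => ?_) x
  · have h1 := isSemiconvex_semiconvexMinorant hv hvg (y + h) l
    have h2 := isSemiconvex_semiconvexMinorant hv hvg (y - h) l
    rw [add_right_comm, ← sub_add_eq_add_sub y l h] at h1
    rw [sub_add_eq_add_sub, sub_right_comm y h l] at h2
    beta_reduce
    linarith
  · linarith [hg y, semiconvexMinorant_le hv hvg (y + h), semiconvexMinorant_le hv hvg (y - h)]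

end InfConvolution

/-! ### Smoothing that preserves moduli of continuity. -/

section Smoothing

variable {X : Type*} [NormedAddCommGroup X] [NormedSpace ℝ X]

/-- The segment is cut into at most `‖x - y‖ / δ + 1` steps shorter than `δ`, each costing at most
`ε`. -/
theorem exists_abs_sub_le_add_mul_norm {f : X → ℝ} (hf : UniformContinuous f) {ε : ℝ}
    (hε : 0 < ε) : ∃ L : ℝ, 0 < L ∧ ∀ x y, |f x - f y| ≤ ε + L * ‖x - y‖ := by
  obtain ⟨δ, hδ, h⟩ := Metric.uniformContinuous_iff.1 hf ε hε
  have step : ∀ (n : ℕ) (x k : X), ‖k‖ < δ → |f (x + (n : ℝ) • k) - f x| ≤ n * ε := by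
    intro n x k hk
    induction n with
    | zero => simp
    | succ n ih =>
      have h1 : |f (x + (n : ℝ) • k + k) - f (x + (n : ℝ) • k)| < ε := by
        rw [← Real.dist_eq]
        exact h (by simpa [dist_eq_norm] using hk)
      have e : x + ((n + 1 : ℕ) : ℝ) • k = x + (n : ℝ) • k + k := by
        push_cast
        module
      rw [e]
      push_cast
      calc _ ≤ _ := abs_sub_le _ (f (x + (n : ℝ) • k)) _
        _ ≤ _ := by linarith
  refine ⟨ε / δ, by positivity, fun x y => ?_⟩
  set n := ⌊‖x - y‖ / δ⌋₊ + 1 with hn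
  have hn0 : (0 : ℝ) < n := by positivity
  have hlt : ‖x - y‖ / δ < n := by rw [hn]; push_cast; exact Nat.lt_floor_add_one _
  have hle : (n : ℝ) ≤ ‖x - y‖ / δ + 1 := by
    rw [hn]; push_cast; linarith [Nat.floor_le (by positivity : 0 ≤ ‖x - y‖ / δ)]
  have := step n y ((n : ℝ)⁻¹ • (x - y)) (by
    rw [norm_smul, norm_inv, Real.norm_of_nonneg hn0.le, inv_mul_lt_iff₀ hn0]
    rwa [div_lt_iff₀ hδ] at hlt)
  rw [smul_inv_smul₀ hn0.ne', add_sub_cancel] at this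
  refine this.trans ((mul_le_mul_of_nonneg_right hle hε.le).trans_eq ?_)
  ring

/-- The power dominates the linear term from `t = ε / L` on, where `l` makes the two equal; below
that, `ε` suffices. This lets the kernel absorb the linear growth of `f`. -/
theorem exists_mul_le_add_mul_rpow {α a L ε : ℝ} (hα : 0 < α) (ha : 0 < a) (hL : 0 < L)
    (hε : 0 < ε) : ∃ l : ℝ, 0 < l ∧ ∀ t, 0 ≤ t → L * t ≤ ε + l * (a * t) ^ (1 + α) := by
  refine ⟨L / (a ^ (1 + α) * (ε / L) ^ α), by positivity, fun t ht => ?_⟩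
  rcases le_total (L * t) ε with h | h
  · have : 0 ≤ L / (a ^ (1 + α) * (ε / L) ^ α) * (a * t) ^ (1 + α) := by positivity
    linarith
  · have h1 : (ε / L) ^ α ≤ t ^ α :=
      Real.rpow_le_rpow (by positivity) ((div_le_iff₀' hL).2 h) hα.le
    rw [Real.mul_rpow ha.le ht, Real.rpow_one_add' ht (by linarith)]
    have e : L / (a ^ (1 + α) * (ε / L) ^ α) * (a ^ (1 + α) * (t * t ^ α))
        = L * t * (t ^ α / (ε / L) ^ α) := by
      field_simp
    rw [e]
    have : 1 ≤ t ^ α / (ε / L) ^ α := (one_le_div (by positivity)).2 h1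
    nlinarith [mul_nonneg hL.le ht]

/-- On a space with a norm of power type `1 + α`, uniformly continuous functions are uniform
limits of Lipschitz functions with `α`-Hölder derivative that have the same moduli of continuity. -/
theorem exists_mem_C1Holder_approx {α : ℝ} (hα : 0 < α) (hX : HasPowerTypeRenorming X α)
    {f : X → ℝ} (hf : UniformContinuous f) {ε : ℝ} (hε : 0 < ε) :
    ∃ u ∈ C1Holder X α ∩ LipFun X, (∀ x, |u x - f x| ≤ ε) ∧
      ∀ h c, (∀ x, |f (x + h) - f x| ≤ c) → ∀ x, |u (x + h) - u x| ≤ c := by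
  obtain ⟨N, ⟨a, b, ha, hb, hN⟩, C, hC, hNC⟩ := hX
  obtain ⟨L, hL, hfL⟩ := exists_abs_sub_le_add_mul_norm hf (half_pos hε)
  obtain ⟨l, hl, hlL⟩ := exists_mul_le_add_mul_rpow hα ha hL (half_pos hε)
  let k : X → ℝ := fun z => l * N z ^ (1 + α)
  have hkL : ∀ z, L * ‖z‖ ≤ ε / 2 + k z := fun z =>
    (hlL _ (norm_nonneg z)).trans (by
      have : (a * ‖z‖) ^ (1 + α) ≤ N z ^ (1 + α) :=
        Real.rpow_le_rpow (by positivity) (hN z).1 (by linarith)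
      have := mul_le_mul_of_nonneg_left this hl.le
      simpa [k] using this)
  have hk0 : k 0 = 0 := by
    simp [k, Real.zero_rpow (by linarith : 1 + α ≠ 0)]
  have hk2 : ∀ h z, k (z + h) + k (z - h) - 2 * k z ≤ l * C * N h ^ (1 + α) := by
    intro h z
    have := mul_le_mul_of_nonneg_left (hNC z h) hl.le
    simp only [k]
    linarith
  have hk : ∀ x y, f x - ε ≤ f y + k (x - y) := fun x y => by
    linarith [(abs_le.1 (hfL x y)).2, hkL (x - y)]
  have hk' : ∀ x y, -f x - ε ≤ -f y + k (x - y) := fun x y => by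
    linarith [(abs_le.1 (hfL x y)).1, hkL (x - y)]
  -- The shifts by `ε` reverse the natural order of the two envelopes and put `f` between `w` and
  -- `g`.
  set g : X → ℝ := fun x => infConv k f x + ε with hg
  set w : X → ℝ := fun x => -infConv k (fun x => -f x) x - ε with hw
  set φ : X → ℝ := fun h => l * C * N h ^ (1 + α) with hφ
  have hwc : IsSemiconvex φ w := fun x h => by
    have := infConv_secondDiff_le hk' (hk2 h) x
    simp only [hw, hφ]
    linarith
  have hwf : ∀ x, f x - ε ≤ w x := fun x => by
    have := infConv_le_self hk' hk0 x
    simp only [hw]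
    linarith
  have hgf : ∀ x, g x ≤ f x + ε := fun x => by
    have := infConv_le_self hk hk0 x
    simp only [hg]
    linarith
  have hwg : ∀ x, w x ≤ g x := fun x => by
    have h1 := sub_le_infConv hk x
    have h2 := sub_le_infConv hk' x
    simp only [hg, hw]
    linarith
  have hmod : ∀ h c, (∀ x, f (x + h) ≤ f x + c) →
      ∀ x, semiconvexMinorant φ g (x + h) ≤ semiconvexMinorant φ g x + c := fun h c hc =>
    semiconvexMinorant_add_le hwc hwg fun x => by
      have := infConv_add_le hk hc x
      simp only [hg]
      linarith
  have hmod' : ∀ h c, (∀ x, |f (x + h) - f x| ≤ c) →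
      ∀ x, |semiconvexMinorant φ g (x + h) - semiconvexMinorant φ g x| ≤ c := by
    intro h c hc x
    have h1 := hmod h c (fun x => by linarith [(abs_le.1 (hc x)).2]) x
    have h2 := hmod (-h) c (fun x => by
      have := (abs_le.1 (hc (x + -h))).1
      rw [neg_add_cancel_right] at this
      linarith) (x + h)
    rw [add_neg_cancel_right] at h2
    rw [abs_le]
    constructor <;> linarith
  refine ⟨semiconvexMinorant φ g, ?_, fun x => ?_, hmod'⟩
  · refine mem_C1Holder_inter_LipFun_of_secondDiff (K := l * C * b ^ (1 + α)) (B := ε / 2 + L) hα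
      (by positivity) ?_ (fun x h => ?_) fun x h hh => ?_
    · refine UniformContinuous.continuous (Metric.uniformContinuous_iff.2 fun η hη => ?_)
      obtain ⟨δ, hδ, hfδ⟩ := Metric.uniformContinuous_iff.1 hf (η / 2) (half_pos hη)
      refine ⟨δ, hδ, fun {x y} hxy => ?_⟩
      have := hmod' (x - y) (η / 2) (fun z => by
        rw [← Real.dist_eq]
        exact (hfδ (by simpa [dist_eq_norm] using hxy)).le) y
      rw [add_sub_cancel] at this
      rw [Real.dist_eq]
      linarith
    · have h1 := isSemiconvex_semiconvexMinorant hwc hwg x h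
      have h2 := semiconvexMinorant_secondDiff_le hwc hwg (h := h) (c := φ h) (fun x => by
        have := infConv_secondDiff_le hk (hk2 h) x
        simp only [hg, hφ]
        linarith) x
      have h3 : φ h ≤ l * C * b ^ (1 + α) * ‖h‖ ^ (1 + α) := by
        rw [mul_assoc _ (b ^ _), ← Real.mul_rpow hb.le (norm_nonneg _)]
        exact mul_le_mul_of_nonneg_left
          (Real.rpow_le_rpow (apply_nonneg N h) (hN h).2 (by linarith)) (by positivity)
      rw [abs_le]
      constructor <;> linarith
    · refine hmod' h _ (fun x => (hfL _ _).trans ?_) x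
      rw [add_sub_cancel_left]
      nlinarith
  · have h1 := le_semiconvexMinorant hwc hwg x
    have h2 := semiconvexMinorant_le hwc hwg x
    rw [abs_le]
    constructor <;> linarith [hwf x, hgf x]

end Smoothing

end VanishingHolder

namespace VanishingHolder

/-! ### Soft thresholding. -/

section Threshold

/-- A smooth soft thresholding function. -/
theorem exists_softThreshold {ε : ℝ} (hε : 0 < ε) :
    ∃ φ ψ : ℝ → ℝ, (∀ t, HasDerivAt φ (ψ t) t) ∧ (∃ K, LipschitzWith K ψ) ∧
      (∀ t, |ψ t| ≤ 1) ∧ (∀ t, |t| ≤ ε → φ t = 0) ∧ ∀ t, |φ t - t| ≤ 2 * ε := by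
  -- The derivative vanishes on `|t| ≤ ε`, equals 1 for `|t| ≥ 2 * ε`, and is affine in `|t|` in
  -- between; its primitive thus lags behind the identity by at most `2 * ε`.
  let ψ : ℝ → ℝ := fun t => max (min ((|t| - ε) / ε) 1) 0
  have hψ0 : ∀ t, 0 ≤ ψ t := fun t => le_max_right _ _
  have hψ1 : ∀ t, ψ t ≤ 1 := fun t => max_le (min_le_right _ _) zero_le_one
  have hψl : LipschitzWith (Real.toNNReal ε⁻¹) ψ := by
    refine ((LipschitzWith.of_dist_le_mul fun s t => ?_).min_const 1).max_const 0
    rw [Real.coe_toNNReal _ (by positivity), Real.dist_eq, Real.dist_eq, ← sub_div,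
      sub_sub_sub_cancel_right, abs_div, abs_of_pos hε, div_eq_inv_mul]
    exact mul_le_mul_of_nonneg_left (abs_abs_sub_abs_le _ _) (by positivity)
  have hψc : Continuous ψ := hψl.continuous
  have hint : ∀ s t, IntervalIntegrable ψ MeasureTheory.volume s t :=
    fun s t => hψc.intervalIntegrable s t
  have hψz : ∀ t, |t| ≤ ε → ψ t = 0 := fun t ht => by
    have : (|t| - ε) / ε ≤ 0 := div_nonpos_of_nonpos_of_nonneg (by linarith) hε.le
    exact max_eq_right ((min_le_left _ _).trans this)
  have hψo : ∀ t, 2 * ε ≤ t → ψ t = 1 := fun t ht => by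
    have : 1 ≤ (|t| - ε) / ε := by
      rw [le_div_iff₀ hε]
      linarith [le_abs_self t]
    simp [ψ, min_eq_right this]
  have hpos : ∀ t, 0 ≤ t → |(∫ s in (0 : ℝ)..t, ψ s) - t| ≤ 2 * ε := by
    intro t ht
    have h1 : (∫ s in (0 : ℝ)..t, ψ s) ≤ t := by
      have := intervalIntegral.integral_mono ht (hint 0 t) (g := fun _ => (1 : ℝ)) (by simp) hψ1
      simpa using this
    have h2 : t - 2 * ε ≤ ∫ s in (0 : ℝ)..t, ψ s := by
      rcases le_total t (2 * ε) with h | h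
      · linarith [intervalIntegral.integral_nonneg ht (fun s _ => hψ0 s) (μ := MeasureTheory.volume)]
      · rw [← intervalIntegral.integral_add_adjacent_intervals (hint 0 (2 * ε)) (hint _ t)]
        have h3 : ∫ s in (2 * ε)..t, ψ s = ∫ s in (2 * ε)..t, (1 : ℝ) :=
          intervalIntegral.integral_congr fun s hs => by
            rw [Set.uIcc_of_le h] at hs
            exact hψo s hs.1
        have h4 := intervalIntegral.integral_nonneg (by positivity : 0 ≤ 2 * ε)
          (fun s _ => hψ0 s) (μ := MeasureTheory.volume)
        rw [h3]
        simp only [intervalIntegral.integral_const, smul_eq_mul, mul_one]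
        linarith
    rw [abs_le]
    constructor <;> linarith
  refine ⟨fun t => ∫ s in (0 : ℝ)..t, ψ s, ψ, fun t => ?_, ⟨_, hψl⟩, fun t => ?_, fun t ht => ?_,
    fun t => ?_⟩
  · exact intervalIntegral.integral_hasDerivAt_right (hint 0 t)
      (hψc.stronglyMeasurableAtFilter _ _) hψc.continuousAt
  · rw [abs_of_nonneg (hψ0 t)]
    exact hψ1 t
  · have : ∫ s in (0 : ℝ)..t, ψ s = ∫ s in (0 : ℝ)..t, (0 : ℝ) :=
      intervalIntegral.integral_congr fun s hs => hψz s (by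
        have := Set.abs_sub_left_of_mem_uIcc hs
        rw [sub_zero, sub_zero] at this
        exact this.trans ht)
    simpa using this
  · rcases le_total 0 t with h | h
    · exact hpos t h
    · have h1 : ∫ s in (0 : ℝ)..t, ψ s = -∫ s in (0 : ℝ)..(-t), ψ s := by
        have := intervalIntegral.integral_comp_neg ψ (a := 0) (b := t)
        rw [neg_zero] at this
        rw [intervalIntegral.integral_symm (-t), ← this, neg_neg]
        exact intervalIntegral.integral_congr fun s _ => by simp [ψ]
      have h2 := hpos (-t) (by linarith)
      beta_reduce
      rw [h1]
      rw [abs_le] at *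
      constructor <;> linarith

variable {X : Type*} [NormedAddCommGroup X] [NormedSpace ℝ X]

/-- In the chain rule, `ψ ∘ u` is Hölder: at distances at most 1 it is Lipschitz and `t ≤ t ^ α`
because `α ≤ 1`; at larger ones its oscillation is at most 2. -/
theorem comp_mem_C1Holder {α : ℝ} (hα₀ : 0 < α) (hα₁ : α ≤ 1) {u : X → ℝ}
    (hu : u ∈ C1Holder X α ∩ LipFun X) {φ ψ : ℝ → ℝ} (hφ : ∀ t, HasDerivAt φ (ψ t) t)
    (hψ : ∃ K, LipschitzWith K ψ) (hψ1 : ∀ t, |ψ t| ≤ 1) : φ ∘ u ∈ C1Holder X α := by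
  obtain ⟨hu1, L, hL⟩ := hu
  obtain ⟨hdiff, c, hc, hD⟩ := mem_C1Holder_iff.1 hu1
  obtain ⟨K, hK⟩ := hψ
  have hfd : ∀ x, HasFDerivAt (φ ∘ u) (ψ (u x) • fderiv ℝ u x) x := fun x =>
    (hφ (u x)).comp_hasFDerivAt x (hdiff x).hasFDerivAt
  refine mem_C1Holder_iff.2 ⟨fun x => (hfd x).differentiableAt, c + (2 + K * L) * L, by positivity,
    fun x y hxy => ?_⟩
  have hr : 0 < ‖x - y‖ := norm_sub_pos_iff.2 hxy
  rw [(hfd x).fderiv, (hfd y).fderiv]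
  have e : ψ (u x) • fderiv ℝ u x - ψ (u y) • fderiv ℝ u y
      = ψ (u x) • (fderiv ℝ u x - fderiv ℝ u y) + (ψ (u x) - ψ (u y)) • fderiv ℝ u y := by
    module
  have h1 : ‖ψ (u x) • (fderiv ℝ u x - fderiv ℝ u y)‖ ≤ c * ‖x - y‖ ^ α := by
    rw [norm_smul]
    exact (mul_le_of_le_one_left (norm_nonneg _) (hψ1 _)).trans (hD x y hxy)
  have h2 : |ψ (u x) - ψ (u y)| ≤ (2 + K * L) * ‖x - y‖ ^ α := by
    have hKL : (0 : ℝ) ≤ K * L := by positivity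
    rcases le_total ‖x - y‖ 1 with h | h
    · have a1 := hK.dist_le_mul (u x) (u y)
      have a2 := mul_le_mul_of_nonneg_left (hL.dist_le_mul x y) K.2
      have a3 := Real.rpow_le_rpow_of_exponent_ge hr h hα₁
      rw [Real.rpow_one] at a3
      rw [Real.dist_eq] at a1
      rw [dist_eq_norm x y] at a2
      have a4 := mul_le_mul_of_nonneg_left a3 hKL
      have : (0 : ℝ) ≤ ‖x - y‖ ^ α := by positivity
      have a5 : (K : ℝ) * dist (u x) (u y) ≤ K * (L * ‖x - y‖) := a2
      linarith
    · have a1 := abs_sub (ψ (u x)) (ψ (u y))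
      have a3 := Real.one_le_rpow h hα₀.le
      have a4 := mul_le_mul_of_nonneg_left a3 hKL
      have := hψ1 (u x)
      have := hψ1 (u y)
      nlinarith
  rw [e]
  refine (norm_add_le _ _).trans ?_
  rw [norm_smul _ (fderiv ℝ u y), Real.norm_eq_abs]
  have h3 : ‖fderiv ℝ u y‖ ≤ L := norm_fderiv_le_of_lipschitz ℝ hL
  have h4 := mul_le_mul h2 h3 (norm_nonneg _) (by positivity)
  linarith

end Threshold

/-! ### Consequences of the assumptions on the modulus. -/

section Modulus

variable {ω : ℝ → ℝ}

theorem IsModulus.exists_le_mul_near_zero (hω : IsModulus ω) {ε : ℝ} (hε : 0 < ε) :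
    ∃ δ, 0 < δ ∧ ∀ t, 0 < t → t < δ → t ≤ ε * ω t := by
  have := hω.tendsto_div.eventually (gt_mem_nhds hε)
  rw [(nhdsGT_basis (0 : ℝ)).eventually_iff] at this
  obtain ⟨δ, hδ, h⟩ := this
  exact ⟨δ, hδ, fun t h0 ht => ((div_lt_iff₀ (hω.pos t h0)).1 (h ⟨h0, ht⟩)).le⟩

theorem IsModulus.exists_mul_lt (hω : IsModulus ω) (c : ℝ) {ε : ℝ} (hε : 0 < ε) :
    ∃ δ, 0 < δ ∧ ∀ t, 0 < t → t < δ → c * ω t < ε := by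
  have h0 : Tendsto (fun t => c * ω t) (𝓝[>] 0) (𝓝 0) := by
    simpa using hω.tendsto_zero.const_mul c
  have := h0.eventually (gt_mem_nhds hε)
  rw [(nhdsGT_basis (0 : ℝ)).eventually_iff] at this
  obtain ⟨δ, hδ, h⟩ := this
  exact ⟨δ, hδ, fun t h0 ht => h ⟨h0, ht⟩⟩

theorem IsModulus.exists_le_mul_at_infinity (hω : IsModulus ω) (B : ℝ) {ε : ℝ} (hε : 0 < ε) :
    ∃ T, 0 < T ∧ ∀ t, T ≤ t → B ≤ ε * ω t := by
  obtain ⟨T, hT⟩ := eventually_atTop.1 (hω.tendsto_atTop.eventually_ge_atTop (B / ε))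
  refine ⟨max T 1, by positivity, fun t ht => ?_⟩
  have := hT t ((le_max_left _ _).trans ht)
  rwa [div_le_iff₀' hε] at this

theorem IsModulus.exists_le_mul_of_lt (hω : IsModulus ω) (T : ℝ) :
    ∃ A, 0 < A ∧ ∀ t, 0 < t → t < T → t ≤ A * ω t := by
  obtain ⟨δ, hδ, h⟩ := hω.exists_le_mul_near_zero one_pos
  have hωδ := hω.pos δ hδ
  refine ⟨max 1 (T / ω δ), by positivity, fun t h0 ht => ?_⟩
  have hωt := hω.pos t h0
  rcases lt_or_ge t δ with htδ | htδ
  · exact (h t h0 htδ).trans (mul_le_mul_of_nonneg_right (le_max_left _ _) hωt.le)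
  · refine le_trans ?_ (mul_le_mul_of_nonneg_right (le_max_right _ _) hωt.le)
    have := hω.mono hδ h0 htδ
    rw [div_mul_eq_mul_div, le_div_iff₀ hωδ]
    exact mul_le_mul ht.le this hωδ.le (h0.trans ht).le

/-- Past some `T`, `ω` outgrows the constant `B`; before it, `t` is at most a multiple of `ω t`, so
a small slope `η` suffices. -/
theorem IsModulus.exists_min_le (hω : IsModulus ω) (B : ℝ) {ε : ℝ} (hε : 0 < ε) :
    ∃ η, 0 < η ∧ ∀ t, 0 < t → min B (η * t) ≤ ε * ω t := by
  obtain ⟨T, hT0, hT⟩ := hω.exists_le_mul_at_infinity B hε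
  obtain ⟨A, hA0, hA⟩ := hω.exists_le_mul_of_lt T
  refine ⟨ε / A, by positivity, fun t ht => ?_⟩
  rcases lt_or_ge t T with h | h
  · refine (min_le_right _ _).trans ?_
    rw [div_mul_eq_mul_div, div_le_iff₀ hA0]
    nlinarith [hA t ht h]
  · exact (min_le_left _ _).trans (hT t h)

variable {X : Type*} [NormedAddCommGroup X]

theorem IsModulus.uniformContinuous (hω : IsModulus ω) {f : X → ℝ}
    (hf : f ∈ HolderSpace X ℝ ω) : UniformContinuous f := by
  obtain ⟨c, _, h⟩ := (mem_holderSpace_iff hω.pos).1 hf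
  refine Metric.uniformContinuous_iff.2 fun ε hε => ?_
  obtain ⟨δ, hδ, hδc⟩ := hω.exists_mul_lt c hε
  refine ⟨δ, hδ, fun {x y} hxy => ?_⟩
  rcases eq_or_ne x y with rfl | hne
  · simpa using hε
  · rw [dist_eq_norm] at hxy ⊢
    exact (h x y hne).trans_lt (hδc _ (norm_sub_pos_iff.2 hne) hxy)

/-- A nonnegative cut-off function of bounded support, large on a given ball, with small
Hölder seminorm. -/
theorem IsModulus.exists_cutoff (hω : IsModulus ω) {B : ℝ} (hB : 0 ≤ B) (R : ℝ) {ε : ℝ}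
    (hε : 0 < ε) : ∃ m : X → ℝ, (∀ x, 0 ≤ m x) ∧ (∀ x, ‖x‖ ≤ R → B ≤ m x) ∧
      (∃ S, 0 < S ∧ ∀ x, S < ‖x‖ → m x = 0) ∧
      ∀ x y, x ≠ y → |m x - m y| ≤ ε * ω ‖x - y‖ := by
  obtain ⟨η, hη, h⟩ := hω.exists_min_le B hε
  -- A radial profile descending with slope `η` from `B` at radius `R` to 0 at radius `R + B / η`.
  let m : X → ℝ := fun x => max (min (B + η * (R - ‖x‖)) B) 0
  have hmB : ∀ x, m x ≤ B := fun x => max_le (min_le_right _ _) hB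
  have hm0 : ∀ x, 0 ≤ m x := fun x => le_max_right _ _
  refine ⟨m, hm0, fun x hx => ?_, ⟨max (R + B / η) 1, by positivity, fun x hx => ?_⟩,
    fun x y hxy => ?_⟩
  · refine le_max_of_le_left (le_min ?_ le_rfl)
    nlinarith
  · refine max_eq_right ((min_le_left _ _).trans ?_)
    have h1 : R + B / η < ‖x‖ := (le_max_left _ _).trans_lt hx
    have h2 : η * (R + B / η) = η * R + B := by field_simp
    nlinarith
  · refine le_trans (le_min ?_ ?_) (h _ (norm_sub_pos_iff.2 hxy))
    · rw [abs_le]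
      constructor <;> linarith [hmB x, hmB y, hm0 x, hm0 y]
    · refine (abs_max_sub_max_le_abs _ _ _).trans ((abs_min_sub_min_le_max _ _ _ _).trans ?_)
      rw [sub_self, abs_zero, max_eq_left (abs_nonneg _), add_sub_add_left_eq_sub, ← mul_sub,
        sub_sub_sub_cancel_left, abs_mul, abs_of_pos hη, norm_sub_rev]
      exact mul_le_mul_of_nonneg_left (abs_norm_sub_norm_le _ _) hη.le

end Modulus

end VanishingHolder

namespace VanishingHolder

/-! ### Stability under limits, and truncation. -/

section Closure

variable {X : Type*} [NormedAddCommGroup X] {ω : ℝ → ℝ}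

theorem abs_sub_le_of_approx {a b c d e : ℝ} (h1 : |a - b| ≤ e) (h2 : |(a - c) - (b - d)| ≤ e) :
    |c - d| ≤ 2 * e := by
  rw [abs_le] at *
  constructor <;> linarith

theorem holderClosure_subset_VCsmall (hω : ∀ t, 0 < t → 0 < ω t) {A : Set (X → ℝ)}
    (hA : A ⊆ VCsmall X ℝ ω) : holderClosure ω A ⊆ VCsmall X ℝ ω := by
  intro f hf
  obtain ⟨hfH, hfa⟩ := (mem_holderClosure_iff hω).1 hf
  refine ⟨(tendsto_osc_zero_iff hω).2 fun ε hε => ?_, hfH⟩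
  obtain ⟨u, huA, hu⟩ := hfa (ε / 2) (half_pos hε)
  obtain ⟨δ, hδ, h⟩ := (tendsto_osc_zero_iff hω).1 (hA huA).1 (ε / 2) (half_pos hε)
  exact ⟨δ, hδ, fun x y hxy hlt =>
    (abs_sub_le_of_approx (h x y hxy hlt) (hu x y hxy)).trans_eq (by ring)⟩

theorem holderClosure_subset_VClarge (hω : ∀ t, 0 < t → 0 < ω t) {A : Set (X → ℝ)}
    (hA : A ⊆ VClarge X ℝ ω) : holderClosure ω A ⊆ VClarge X ℝ ω := by
  intro f hf
  obtain ⟨hfH, hfa⟩ := (mem_holderClosure_iff hω).1 hf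
  refine ⟨(tendsto_osc_atTop_iff hω).2 fun ε hε => ?_, hfH⟩
  obtain ⟨u, huA, hu⟩ := hfa (ε / 2) (half_pos hε)
  obtain ⟨T, h⟩ := (tendsto_osc_atTop_iff hω).1 (hA huA).1 (ε / 2) (half_pos hε)
  exact ⟨T, fun x y hxy hle =>
    (abs_sub_le_of_approx (h x y hxy hle) (hu x y hxy)).trans_eq (by ring)⟩

theorem holderClosure_subset_VCfar (hω : ∀ t, 0 < t → 0 < ω t) {A : Set (X → ℝ)}
    (hA : A ⊆ VCfar X ℝ ω) : holderClosure ω A ⊆ VCfar X ℝ ω := by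
  intro f hf
  obtain ⟨hfH, hfa⟩ := (mem_holderClosure_iff hω).1 hf
  refine ⟨(tendsto_oscFar_atTop_iff hω).2 fun ε hε => ?_, hfH⟩
  obtain ⟨u, huA, hu⟩ := hfa (ε / 2) (half_pos hε)
  obtain ⟨T, h⟩ := (tendsto_oscFar_atTop_iff hω).1 (hA huA).1 (ε / 2) (half_pos hε)
  exact ⟨T, fun x y hxy hx hy =>
    (abs_sub_le_of_approx (h x y hxy hx hy) (hu x y hxy)).trans_eq (by ring)⟩

theorem holderClosure_subset_VC (hω : ∀ t, 0 < t → 0 < ω t) {A : Set (X → ℝ)}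
    (hA : A ⊆ VC X ℝ ω) : holderClosure ω A ⊆ VC X ℝ ω := fun _ hf =>
  ⟨⟨holderClosure_subset_VCsmall hω (fun _ h => (hA h).1.1) hf,
    holderClosure_subset_VCfar hω (fun _ h => (hA h).1.2) hf⟩,
    holderClosure_subset_VClarge hω (fun _ h => (hA h).2) hf⟩

theorem IsModulus.lipFun_inter_holderSpace_subset (hω : IsModulus ω) :
    LipFun X ∩ HolderSpace X ℝ ω ⊆ VCsmall X ℝ ω := by
  rintro f ⟨⟨K, hK⟩, hfH⟩
  refine ⟨(tendsto_osc_zero_iff hω.pos).2 fun ε hε => ?_, hfH⟩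
  obtain ⟨δ, hδ, h⟩ := hω.exists_le_mul_near_zero (ε := ε / (K + 1)) (by positivity)
  refine ⟨δ, hδ, fun x y hxy hlt => ?_⟩
  have h0 := norm_sub_pos_iff.2 hxy
  have h1 := hK.dist_le_mul x y
  rw [dist_eq_norm, dist_eq_norm] at h1
  have h2 := h _ h0 hlt
  rw [div_mul_eq_mul_div, le_div_iff₀ (by positivity)] at h2
  linarith

/-- Uniformly close functions, both of small oscillation at small scales, are close in the Hölder
seminorm. -/
theorem IsModulus.abs_sub_sub_le (hω : IsModulus ω) {f v : X → ℝ} {ε δ : ℝ} (hε : 0 ≤ ε)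
    (hδ : 0 < δ) (hf : ∀ x y, x ≠ y → ‖x - y‖ < δ → |f x - f y| ≤ ε * ω ‖x - y‖)
    (hv : ∀ x y, x ≠ y → ‖x - y‖ < δ → |v x - v y| ≤ ε * ω ‖x - y‖)
    (hvf : ∀ x, |v x - f x| ≤ ε * ω δ) (x y : X) (hxy : x ≠ y) :
    |(v x - f x) - (v y - f y)| ≤ 2 * ε * ω ‖x - y‖ := by
  rcases lt_or_ge ‖x - y‖ δ with h | h
  · have h1 := hf x y hxy h
    have h2 := hv x y hxy h
    rw [abs_le] at *
    constructor <;> linarith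
  · have h1 := hvf x
    have h2 := hvf y
    have h3 := mul_le_mul_of_nonneg_left (hω.mono hδ (norm_sub_pos_iff.2 hxy) h) hε
    rw [abs_le] at *
    constructor <;> linarith

/-- For a fixed shift `h = x - y`, both `P ‖h‖` and the bound are independent of the base point, so
preservation of moduli applies one shift at a time. -/
theorem abs_sub_le_of_modulus {f u : X → ℝ}
    (hu : ∀ h c, (∀ x, |f (x + h) - f x| ≤ c) → ∀ x, |u (x + h) - u x| ≤ c) {c : ℝ}
    {P : ℝ → Prop} (hf : ∀ x y, x ≠ y → P ‖x - y‖ → |f x - f y| ≤ c * ω ‖x - y‖) (x y : X)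
    (hxy : x ≠ y) (hP : P ‖x - y‖) : |u x - u y| ≤ c * ω ‖x - y‖ := by
  have := hu (x - y) (c * ω ‖x - y‖) (fun z => by
    have := hf (z + (x - y)) z
    rw [add_sub_cancel_left] at this
    exact this (by simpa [sub_eq_zero] using hxy) hP) y
  rwa [add_sub_cancel] at this

/-- Functions with vanishing oscillation at large scales and far away are approximated by
truncations of bounded support. -/
theorem exists_truncation (hω : IsModulus ω) {f : X → ℝ} (hf : f ∈ VC X ℝ ω) {ε : ℝ}
    (hε : 0 < ε) : ∃ h ∈ HolderSpace X ℝ ω, (∃ S, 0 < S ∧ ∀ x, S < ‖x‖ → h x = 0) ∧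
      (∃ δ, 0 < δ ∧ ∀ x y, x ≠ y → ‖x - y‖ < δ → |h x - h y| ≤ ε * ω ‖x - y‖) ∧
      ∀ x y, x ≠ y → |(h x - f x) - (h y - f y)| ≤ 2 * ε * ω ‖x - y‖ := by
  obtain ⟨⟨⟨hs, hH⟩, hfar, -⟩, hlarge, -⟩ := hf
  obtain ⟨c, hc, hfc⟩ := (mem_holderSpace_iff hω.pos).1 hH
  obtain ⟨δ, hδ, hfs⟩ := (tendsto_osc_zero_iff hω.pos).1 hs ε hε
  obtain ⟨T₁, hT₁⟩ := (tendsto_oscFar_atTop_iff hω.pos).1 hfar ε hε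
  obtain ⟨T₂, hT₂⟩ := (tendsto_osc_atTop_iff hω.pos).1 hlarge ε hε
  simp only [Real.norm_eq_abs] at hfc hfs hT₁ hT₂
  set Δ := max (max T₁ T₂) 1 with hΔ
  have hΔ0 : 0 < Δ := by positivity
  have hΔ1 : T₁ ≤ Δ := (le_max_left _ _).trans (le_max_left _ _)
  have hΔ2 : T₂ ≤ Δ := (le_max_right _ _).trans (le_max_left _ _)
  have hω2 := hω.pos (2 * Δ) (by positivity)
  have hB : ∀ x, ‖x‖ ≤ 2 * Δ → |f x| ≤ |f 0| + c * ω (2 * Δ) := fun x hx => by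
    rcases eq_or_ne x 0 with rfl | h0
    · have : 0 ≤ c * ω (2 * Δ) := by positivity
      linarith
    · have h1 := hfc x 0 h0
      rw [sub_zero] at h1
      have h2 := mul_le_mul_of_nonneg_left
        (hω.mono (norm_pos_iff.2 h0) (by positivity : 0 < 2 * Δ) hx) hc
      linarith [abs_sub_abs_le_abs_sub (f x) (f 0)]
  obtain ⟨m, hm0, hmB, ⟨S, hS, hmS⟩, hm⟩ := hω.exists_cutoff (X := X)
    (B := |f 0| + c * ω (2 * Δ)) (by positivity) (2 * Δ) hε
  -- Clamping does nothing on the ball of radius `2 * Δ`, where `|f| ≤ m`, and elsewhere its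
  -- increments are controlled by those of `f` and `m`.
  let h : X → ℝ := fun x => max (-m x) (min (f x) (m x))
  have hhf : ∀ x, ‖x‖ ≤ 2 * Δ → h x = f x := fun x hx => by
    have := abs_le.1 ((hB x hx).trans (hmB x hx))
    simp only [h]
    rw [min_eq_left this.2, max_eq_right this.1]
  have hhm : ∀ x y, |h x - h y| ≤ max |f x - f y| |m x - m y| := fun x y => by
    refine (abs_max_sub_max_le_max _ _ _ _).trans (max_le ?_ (abs_min_sub_min_le_max _ _ _ _))
    rw [neg_sub_neg, abs_sub_comm]
    exact le_max_right _ _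
  have hωp : ∀ x y : X, x ≠ y → 0 < ω ‖x - y‖ := fun x y hxy => hω.pos _ (norm_sub_pos_iff.2 hxy)
  refine ⟨h, (mem_holderSpace_iff hω.pos).2 ⟨c + ε, by positivity, fun x y hxy => ?_⟩,
    ⟨S, hS, fun x hx => ?_⟩, ⟨δ, hδ, fun x y hxy hlt => ?_⟩, fun x y hxy => ?_⟩
  · refine (hhm x y).trans (max_le ((hfc x y hxy).trans ?_) ((hm x y hxy).trans ?_)) <;>
      nlinarith [hωp x y hxy]
  · simp [h, hmS x hx]
  · exact (hhm x y).trans (max_le (hfs x y hxy hlt) (hm x y hxy))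
  · have key : (‖x‖ ≤ 2 * Δ ∧ ‖y‖ ≤ 2 * Δ) ∨ |f x - f y| ≤ ε * ω ‖x - y‖ := by
      rcases le_or_gt ‖x‖ Δ with hx | hx
      · rcases le_or_gt ‖y‖ (2 * Δ) with hy | hy
        · exact Or.inl ⟨by linarith, hy⟩
        · refine Or.inr (hT₂ x y hxy (hΔ2.trans ?_))
          have := norm_sub_norm_le y x
          rw [norm_sub_rev] at this
          linarith
      · rcases le_or_gt ‖y‖ Δ with hy | hy
        · rcases le_or_gt ‖x‖ (2 * Δ) with hx' | hx'
          · exact Or.inl ⟨hx', by linarith⟩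
          · refine Or.inr (hT₂ x y hxy (hΔ2.trans ?_))
            have := norm_sub_norm_le x y
            linarith
        · exact Or.inr (hT₁ x y hxy (hΔ1.trans_lt hx) (hΔ1.trans_lt hy))
    rcases key with ⟨hx, hy⟩ | hle
    · rw [hhf x hx, hhf y hy, sub_self, sub_self, sub_self, abs_zero]
      have := hωp x y hxy
      positivity
    · have h1 := (hhm x y).trans (max_le hle (hm x y hxy))
      rw [abs_le] at *
      constructor <;> linarith

end Closure

/-! ### The four inclusions. -/

section Main

variable {X : Type*} [NormedAddCommGroup X] [NormedSpace ℝ X] {ω : ℝ → ℝ} {α : ℝ}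

theorem VCsmall_subset_holderClosure (hα₀ : 0 < α) (hX : HasPowerTypeRenorming X α)
    (hω : IsModulus ω) :
    VCsmall X ℝ ω ⊆ holderClosure ω (C1Holder X α ∩ LipFun X ∩ HolderSpace X ℝ ω) := by
  rintro f ⟨hfs, hfH⟩
  refine (mem_holderClosure_iff hω.pos).2 ⟨hfH, fun ε hε => ?_⟩
  obtain ⟨δ, hδ, hf⟩ := (tendsto_osc_zero_iff hω.pos).1 hfs (ε / 2) (half_pos hε)
  have hωδ := hω.pos δ hδ
  obtain ⟨u, hu, huf, hmod⟩ := exists_mem_C1Holder_approx hα₀ hX (hω.uniformContinuous hfH)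
    (mul_pos (half_pos hε) hωδ)
  obtain ⟨c, hc, hfc⟩ := (mem_holderSpace_iff hω.pos).1 hfH
  refine ⟨u, ⟨hu, (mem_holderSpace_iff hω.pos).2 ⟨c, hc, fun x y hxy => ?_⟩⟩, fun x y hxy => ?_⟩
  · exact abs_sub_le_of_modulus hmod (P := fun _ => True) (fun x y hxy _ => hfc x y hxy) x y hxy
      trivial
  · refine (hω.abs_sub_sub_le (half_pos hε).le hδ hf ?_ huf x y hxy).trans_eq (by ring)
    exact abs_sub_le_of_modulus hmod (P := fun t => t < δ) hf

/-- Functions with Hölder derivative and bounded support are bounded and Lipschitz. -/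
theorem exists_lipschitz_of_boundedSupport (hα₀ : 0 < α) {f : X → ℝ}
    (hf : f ∈ C1Holder X α ∩ BoundedSupport X) :
    f ∈ LipFun X ∧ ∃ M, ∀ x y, |f x - f y| ≤ M := by
  obtain ⟨hf1, R, hR, hfR⟩ := hf
  obtain ⟨hdiff, c, hc, hD⟩ := mem_C1Holder_iff.1 hf1
  rcases subsingleton_or_nontrivial X with hX | hX
  · exact ⟨⟨0, LipschitzWith.of_dist_le_mul fun x y => by simp [Subsingleton.elim x y]⟩, 0,
      fun x y => by simp [Subsingleton.elim x y]⟩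
  -- At a point beyond the support both `f` and its derivative vanish; comparison with it turns the
  -- Hölder bound on the derivative into a uniform bound, and then bounds `f`.
  obtain ⟨z, hz⟩ := NormedSpace.exists_lt_norm ℝ X R
  have hfd : ∀ x : X, R < ‖x‖ → fderiv ℝ f x = 0 := fun x hx => by
    have : f =ᶠ[𝓝 x] fun _ => 0 := by
      filter_upwards [(isOpen_lt continuous_const continuous_norm).mem_nhds hx] with y hy
      exact hfR y hy
    rw [this.fderiv_eq]
    simp
  have hbd : ∀ x, ‖fderiv ℝ f x‖ ≤ c * (R + ‖z‖) ^ α := fun x => by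
    rcases lt_or_ge R ‖x‖ with hx | hx
    · rw [hfd x hx, norm_zero]
      positivity
    · have hxz : x ≠ z := by rintro rfl; linarith
      have := hD x z hxz
      rw [hfd z hz, sub_zero] at this
      refine this.trans (mul_le_mul_of_nonneg_left ?_ hc)
      exact Real.rpow_le_rpow (norm_nonneg _) ((norm_sub_le _ _).trans (by linarith)) hα₀.le
  have hLip : LipschitzWith (Real.toNNReal (c * (R + ‖z‖) ^ α)) f :=
    lipschitzWith_of_nnnorm_fderiv_le hdiff fun x => by
      rw [← NNReal.coe_le_coe, coe_nnnorm, Real.coe_toNNReal _ (by positivity)]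
      exact hbd x
  have hb : ∀ x, |f x| ≤ c * (R + ‖z‖) ^ α * (R + ‖z‖) := fun x => by
    rcases lt_or_ge R ‖x‖ with hx | hx
    · rw [hfR x hx, abs_zero]
      positivity
    · have := hLip.dist_le_mul x z
      rw [Real.coe_toNNReal _ (by positivity), hfR z hz, Real.dist_eq, sub_zero, dist_eq_norm] at this
      refine this.trans (mul_le_mul_of_nonneg_left ?_ (by positivity))
      exact (norm_sub_le _ _).trans (by linarith)
  exact ⟨⟨_, hLip⟩, _, fun x y => (abs_sub _ _).trans (add_le_add (hb x) (hb y))⟩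

theorem C1Holder_inter_boundedSupport_subset_VC (hα₀ : 0 < α) (hω : IsModulus ω) :
    C1Holder X α ∩ BoundedSupport X ⊆ VC X ℝ ω := by
  intro f hf
  obtain ⟨hL, M, hM⟩ := exists_lipschitz_of_boundedSupport hα₀ hf
  obtain ⟨K, hK⟩ := id hL
  obtain ⟨_, R, hR, hfR⟩ := hf
  have hH : f ∈ HolderSpace X ℝ ω := by
    obtain ⟨T, hT0, hT⟩ := hω.exists_le_mul_at_infinity M one_pos
    obtain ⟨A, hA0, hA⟩ := hω.exists_le_mul_of_lt T
    refine (mem_holderSpace_iff hω.pos).2 ⟨K * A + 1, by positivity, fun x y hxy => ?_⟩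
    have h0 := norm_sub_pos_iff.2 hxy
    have hω0 := hω.pos _ h0
    rw [Real.norm_eq_abs, add_mul]
    rcases lt_or_ge ‖x - y‖ T with h | h
    · have h1 := hK.dist_le_mul x y
      rw [Real.dist_eq, dist_eq_norm] at h1
      have h2 := mul_le_mul_of_nonneg_left (hA _ h0 h) K.2
      have h3 : (K : ℝ) * ‖x - y‖ ≤ K * (A * ω ‖x - y‖) := h2
      linarith
    · have : 0 ≤ K * A * ω ‖x - y‖ := by positivity
      linarith [hM x y, hT _ h]
  refine ⟨⟨hω.lipFun_inter_holderSpace_subset ⟨hL, hH⟩, ?_, hH⟩, ?_, hH⟩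
  · refine (tendsto_oscFar_atTop_iff hω.pos).2 fun ε hε => ⟨R, fun x y hxy hx hy => ?_⟩
    rw [hfR x hx, hfR y hy, sub_zero, norm_zero]
    exact (mul_pos hε (hω.pos _ (norm_sub_pos_iff.2 hxy))).le
  · refine (tendsto_osc_atTop_iff hω.pos).2 fun ε hε => ?_
    obtain ⟨T, _, hT⟩ := hω.exists_le_mul_at_infinity M hε
    exact ⟨T, fun x y _ h => (hM x y).trans (hT _ h)⟩

theorem VC_subset_holderClosure (hα₀ : 0 < α) (hα₁ : α ≤ 1) (hX : HasPowerTypeRenorming X α)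
    (hω : IsModulus ω) :
    VC X ℝ ω ⊆ holderClosure ω (C1Holder X α ∩ BoundedSupport X) := by
  intro f hf
  refine (mem_holderClosure_iff hω.pos).2 ⟨hf.1.1.2, fun ε hε => ?_⟩
  have hε4 : 0 < ε / 4 := by positivity
  obtain ⟨h, hhH, ⟨S, hS, hhS⟩, ⟨δ, hδ, hhs⟩, hhf⟩ := exists_truncation hω hf hε4
  have hωδ := hω.pos δ hδ
  -- Smoothing costs `η` and thresholding `2 * η`, together the `ε / 4 * ω δ` allowed. Truncation
  -- and smoothing then each contribute `ε / 2` to the seminorm.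
  set η := ε / 4 * ω δ / 3 with hη
  have hη0 : 0 < η := by positivity
  obtain ⟨u, hu, huh, hmod⟩ := exists_mem_C1Holder_approx hα₀ hX (hω.uniformContinuous hhH) hη0
  -- Where `h` vanishes, `u` need not, but `|u| ≤ η` there, which is the range that `φ` sends to 0.
  obtain ⟨φ, ψ, hφ, hψ, hψ1, hφ0, hφη⟩ := exists_softThreshold hη0
  have hφl : ∀ s t, |φ s - φ t| ≤ |s - t| := fun s t => by
    have : LipschitzWith 1 φ := lipschitzWith_of_nnnorm_deriv_le
      (fun t => (hφ t).differentiableAt) fun t => by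
        rw [(hφ t).deriv, ← NNReal.coe_le_coe, coe_nnnorm]
        exact hψ1 t
    simpa [Real.dist_eq] using this.dist_le_mul s t
  refine ⟨φ ∘ u, ⟨comp_mem_C1Holder hα₀ hα₁ hu hφ hψ hψ1, S, hS, fun x hx => hφ0 _ ?_⟩,
    fun x y hxy => ?_⟩
  · simpa [hhS x hx] using huh x
  · have hus := abs_sub_le_of_modulus hmod (P := fun t => t < δ) hhs
    have h1 := hω.abs_sub_sub_le (v := φ ∘ u) hε4.le hδ hhs
      (fun x y hxy hlt => (hφl _ _).trans (hus x y hxy hlt)) (fun x => by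
        have h2 := huh x
        have h3 := hφη (u x)
        have h4 : ε / 4 * ω δ = 3 * η := by rw [hη]; ring
        rw [h4, Function.comp_apply]
        rw [abs_le] at *
        constructor <;> linarith) x y hxy
    have h2 := hhf x y hxy
    rw [Real.norm_eq_abs]
    rw [abs_le] at *
    constructor <;> linarith

end Main

end VanishingHolder

theorem mainTheorem3 {X : Type*} [NormedAddCommGroup X] [NormedSpace ℝ X] [CompleteSpace X]
    (α : ℝ) (hα₀ : 0 < α) (hα₁ : α ≤ 1) (hX : VanishingHolder.HasPowerTypeRenorming X α)
    (ω : ℝ → ℝ) (hω : VanishingHolder.IsModulus ω) :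
    VanishingHolder.holderClosure ω
        (VanishingHolder.C1Holder X α ∩ VanishingHolder.LipFun X ∩
          VanishingHolder.HolderSpace X ℝ ω) =
      VanishingHolder.VCsmall X ℝ ω ∧
    VanishingHolder.holderClosure ω
        (VanishingHolder.C1Holder X α ∩ VanishingHolder.BoundedSupport X) =
      VanishingHolder.VC X ℝ ω := by
  refine ⟨Set.Subset.antisymm ?_ (VanishingHolder.VCsmall_subset_holderClosure hα₀ hX hω),
    Set.Subset.antisymm ?_ (VanishingHolder.VC_subset_holderClosure hα₀ hα₁ hX hω)⟩
  · exact VanishingHolder.holderClosure_subset_VCsmall hω.pos fun _ h =>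
      hω.lipFun_inter_holderSpace_subset ⟨h.1.2, h.2⟩
  · exact VanishingHolder.holderClosure_subset_VC hω.pos
      (VanishingHolder.C1Holder_inter_boundedSupport_subset_VC hα₀ hω)
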